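/- **Theorem 3.1.** Let $D\subset\mathbb R^3$ be a bounded Lipschitz domain, let $c>0$, $t_0\in\mathbb R$, $K>0$, and let $\hat x\in\mathbb R^3$ with $|\hat x|=1$. Let $H^{2}(D)=W^{2,2}(D)$ be the Sobolev space of complex-valued functions (no boundary condition), let $H^{-2}(D)$ be the space of bounded linear functionals on $H^2(D)$, and let $L:H^{-2}(D)\to L^2(0,K)$ be the operator $$(Lu)(\tau)=\int_D e^{-i\tau(c^{-1}\hat x\cdot z-t_0)}\,u(z)\,dz,\qquad \tau\in(0,K),$$ where the integral denotes the bilinear duality pairing of $u\in H^{-2}(D)$ with the smooth function $z\mapsto e^{-i\tau(c^{-1}\hat x\cdot z-t_0)}$ in $H^2(D)$. Write $\hat x\cdot D=\{\hat x\cdot z: z\in D\}$. For $\eta\in\mathbb R$ define the closed shifted strip $$K_{D,\eta}^{(\hat x)}=\{y\in\mathbb R^3:\ \inf(\hat x\cdot D)-ct_0+c\eta\ \le\ \hat x\cdot y\ \le\ \sup(\hat x\cdot D)-ct_0+c\eta\}.$$ Then for every $\eta\in\mathbb R$ and every $y\in\mathbb R^3$, the test function $\phi_{y,\eta}(k)=e^{-ik(c^{-1}\hat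 x\cdot y-\eta)}$, $k\in(0,K)$, belongs to $\operatorname{Range}(L)$ if and only if $y\in K_{D,\eta}^{(\hat x)}$. -/

import Mathlib

open MeasureTheory Set Topology
open scoped ContDiff

noncomputable section

namespace FarField

/-- Physical space `ℝ³` with the Euclidean norm. -/
abbrev E3 := EuclideanSpace ℝ (Fin 3)

/-- The `i`-th standard unit vector of `ℝ³`. -/
abbrev stdVec (i : Fin 3) : E3 := EuclideanSpace.single i (1 : ℝ)

/-- The complex Hilbert space `L²(D)` for Lebesgue measure. -/
abbrev L2 (D : Set E3) := Lp ℂ 2 ((volume : Measure E3).restrict D)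

/-- The complex Hilbert space `L²(0, K)`. -/
abbrev L2Interval (K : ℝ) := Lp ℂ 2 ((volume : Measure ℝ).restrict (Ioo 0 K))

/-- A bounded Lipschitz domain: a bounded, connected (in particular non-empty) open set which, in a
ball around each of its boundary points and after a choice of a vertical unit direction `e`, is the
part of that ball lying strictly above the graph of a Lipschitz function `g` of the horizontal
coordinate `x - ⟪e, x⟫ e`. -/
structure IsBoundedLipschitzDomain (D : Set E3) : Prop where
  isOpen : IsOpen D
  isConnected : IsConnected D
  isBounded : Bornology.IsBounded D
  lipschitz_boundary : ∀ p ∈ frontier D, ∃ r > 0, ∃ e : E3, ‖e‖ = 1 ∧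
    ∃ (M : NNReal) (g : E3 → ℝ), LipschitzWith M g ∧
      ∀ x ∈ Metric.ball p r, x ∈ D ↔ g (x - inner ℝ e x • e) < inner ℝ e x

/-- `v` is the weak partial derivative `∂ᵢ u` on `D`, tested against all complex valued smooth
functions with compact support in `D`. -/
def HasWeakDeriv (D : Set E3) (i : Fin 3) (u v : L2 D) : Prop :=
  ∀ φ : E3 → ℂ, ContDiff ℝ ∞ φ → HasCompactSupport φ → tsupport φ ⊆ D →
    ∫ x in D, u x * fderiv ℝ φ x (stdVec i) = - ∫ x in D, v x * φ x

/-- Index set for a function, its three first and its nine second derivatives. -/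
abbrev JetIndex := Unit ⊕ Fin 3 ⊕ Fin 3 × Fin 3

lemma memLp_test {D : Set E3} {φ : E3 → ℂ} (h : Continuous φ) (hc : HasCompactSupport φ) :
    MemLp φ 2 ((volume : Measure E3).restrict D) :=
  (h.memLp_of_hasCompactSupport hc).mono_measure Measure.restrict_le_self

lemma integrable_mul_test {D : Set E3} (u : L2 D) {φ : E3 → ℂ} (h : Continuous φ)
    (hc : HasCompactSupport φ) :
    Integrable (fun x => u x * φ x) ((volume : Measure E3).restrict D) :=
  (Lp.memLp u).integrable_mul (memLp_test h hc)

lemma continuous_fderiv_test {φ : E3 → ℂ} (h : ContDiff ℝ ∞ φ) (i : Fin 3) :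
    Continuous (fun x => fderiv ℝ φ x (stdVec i)) :=
  (h.continuous_fderiv (by simp)).clm_apply continuous_const

lemma hasCompactSupport_fderiv_test {φ : E3 → ℂ} (hc : HasCompactSupport φ) (i : Fin 3) :
    HasCompactSupport (fun x => fderiv ℝ φ x (stdVec i)) :=
  hc.fderiv_apply ℝ (stdVec i)

lemma HasWeakDeriv.add {D : Set E3} {i : Fin 3} {u v u' v' : L2 D} (h : HasWeakDeriv D i u v)
    (h' : HasWeakDeriv D i u' v') : HasWeakDeriv D i (u + u') (v + v') := by
  intro φ hφ hc hs
  have h1 := continuous_fderiv_test hφ i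
  have h2 := hasCompactSupport_fderiv_test hc i
  have e1 : ∫ x in D, (u + u') x * fderiv ℝ φ x (stdVec i)
      = ∫ x in D, (u x * fderiv ℝ φ x (stdVec i) + u' x * fderiv ℝ φ x (stdVec i)) := by
    refine integral_congr_ae ?_
    filter_upwards [Lp.coeFn_add u u'] with x hx
    rw [hx, Pi.add_apply, add_mul]
  have e2 : ∫ x in D, (v + v') x * φ x = ∫ x in D, (v x * φ x + v' x * φ x) := by
    refine integral_congr_ae ?_
    filter_upwards [Lp.coeFn_add v v'] with x hx
    rw [hx, Pi.add_apply, add_mul]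
  rw [e1, e2, integral_add (integrable_mul_test u h1 h2) (integrable_mul_test u' h1 h2),
    integral_add (integrable_mul_test v hφ.continuous hc)
      (integrable_mul_test v' hφ.continuous hc), h φ hφ hc hs, h' φ hφ hc hs]
  ring

lemma HasWeakDeriv.smul {D : Set E3} {i : Fin 3} {u v : L2 D} (a : ℂ)
    (h : HasWeakDeriv D i u v) : HasWeakDeriv D i (a • u) (a • v) := by
  intro φ hφ hc hs
  have e1 : ∫ x in D, (a • u) x * fderiv ℝ φ x (stdVec i)
      = ∫ x in D, a * (u x * fderiv ℝ φ x (stdVec i)) := by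
    refine integral_congr_ae ?_
    filter_upwards [Lp.coeFn_smul a u] with x hx
    rw [hx, Pi.smul_apply, smul_eq_mul, mul_assoc]
  have e2 : ∫ x in D, (a • v) x * φ x = ∫ x in D, a * (v x * φ x) := by
    refine integral_congr_ae ?_
    filter_upwards [Lp.coeFn_smul a v] with x hx
    rw [hx, Pi.smul_apply, smul_eq_mul, mul_assoc]
  rw [e1, e2, integral_const_mul, integral_const_mul, h φ hφ hc hs, mul_neg]

lemma hasWeakDeriv_zero (D : Set E3) (i : Fin 3) : HasWeakDeriv D i 0 0 := by
  have key : ∀ ψ : E3 → ℂ, ∫ x in D, (0 : L2 D) x * ψ x = 0 := by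
    intro ψ
    refine integral_eq_zero_of_ae ?_
    filter_upwards [Lp.coeFn_zero ℂ 2 ((volume : Measure E3).restrict D)] with x hx
    rw [hx, Pi.zero_apply]
    exact zero_mul _
  intro φ _ _ _
  rw [key, key, neg_zero]

/-- The Sobolev space `H²(D) = W^{2,2}(D)` (no boundary condition), with the inner product and norm
`‖u‖² = ‖u‖²_{L²} + ∑ᵢ ‖∂ᵢu‖²_{L²} + ∑ᵢⱼ ‖∂ⱼ∂ᵢu‖²_{L²}`. An element is recorded as the family
consisting of `u` and its weak derivatives, which are determined by `u` when `D` is open. -/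
def H2 (D : Set E3) : Submodule ℂ (PiLp 2 (fun _ : JetIndex => L2 D)) where
  carrier := {U | (∀ i, HasWeakDeriv D i (U (.inl ())) (U (.inr (.inl i)))) ∧
    ∀ i j, HasWeakDeriv D j (U (.inr (.inl i))) (U (.inr (.inr (i, j))))}
  add_mem' := fun h h' =>
    ⟨fun i => (h.1 i).add (h'.1 i), fun i j => (h.2 i j).add (h'.2 i j)⟩
  zero_mem' := ⟨fun i => hasWeakDeriv_zero D i, fun _ j => hasWeakDeriv_zero D j⟩
  smul_mem' := fun a _ h => ⟨fun i => (h.1 i).smul a, fun i j => (h.2 i j).smul a⟩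

/-- `H⁻²(D)`: the space of bounded linear functionals on `H²(D)`. -/
abbrev HNeg2 (D : Set E3) := StrongDual ℂ (H2 D)

lemma isFiniteMeasure_restrict {D : Set E3} (hD : Bornology.IsBounded D) :
    IsFiniteMeasure ((volume : Measure E3).restrict D) :=
  ⟨by rw [Measure.restrict_apply_univ]; exact hD.measure_lt_top⟩

lemma ae_mem_closure (D : Set E3) : ∀ᵐ x ∂((volume : Measure E3).restrict D), x ∈ closure D :=
  ae_restrict_of_ae_restrict_of_subset subset_closure
    (ae_restrict_mem isClosed_closure.measurableSet)

lemma memLp_of_continuous {D : Set E3} (hD : Bornology.IsBounded D) {f : E3 → ℂ}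
    (hf : Continuous f) : MemLp f 2 ((volume : Measure E3).restrict D) := by
  have := isFiniteMeasure_restrict hD
  obtain ⟨C, hC⟩ := hD.isCompact_closure.exists_bound_of_continuousOn hf.continuousOn
  refine MemLp.of_bound hf.aestronglyMeasurable C ?_
  filter_upwards [ae_mem_closure D] with x hx using hC x hx

/-- The class in `L²(D)` of a continuous function on `ℝ³`, for bounded `D`. -/
def toL2 {D : Set E3} (hD : Bornology.IsBounded D) (f : E3 → ℂ) (hf : Continuous f) : L2 D :=
  (memLp_of_continuous hD hf).toLp f

/-- Classical derivatives are weak derivatives. -/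
lemma hasWeakDeriv_toL2 {D : Set E3} (hD : Bornology.IsBounded D) (i : Fin 3) {f f' : E3 → ℂ}
    (hf : Continuous f) (hf' : Continuous f') (hd : Differentiable ℝ f)
    (h : ∀ x, fderiv ℝ f x (stdVec i) = f' x) :
    HasWeakDeriv D i (toL2 hD f hf) (toL2 hD f' hf') := by
  intro φ hφ hc hs
  have h1 := continuous_fderiv_test hφ i
  have h2 := hasCompactSupport_fderiv_test hc i
  have e1 : ∫ x in D, (toL2 hD f hf) x * fderiv ℝ φ x (stdVec i)
      = ∫ x, f x * fderiv ℝ φ x (stdVec i) := by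
    refine Eq.trans (integral_congr_ae ?_)
      (setIntegral_eq_integral_of_forall_compl_eq_zero (s := D) fun x hx => ?_)
    · filter_upwards [(memLp_of_continuous hD hf).coeFn_toLp] with x hx
      rw [toL2, hx]
    · have hx' : x ∉ tsupport φ := fun h => hx (hs h)
      have : fderiv ℝ φ x = 0 := by
        by_contra hne
        exact hx' (support_fderiv_subset ℝ hne)
      simp [this]
  have e2 : ∫ x in D, (toL2 hD f' hf') x * φ x = ∫ x, f' x * φ x := by
    refine Eq.trans (integral_congr_ae ?_)
      (setIntegral_eq_integral_of_forall_compl_eq_zero (s := D) fun x hx => ?_)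
    · filter_upwards [(memLp_of_continuous hD hf').coeFn_toLp] with x hx
      rw [toL2, hx]
    · have hx' : x ∉ tsupport φ := fun h => hx (hs h)
      simp [image_eq_zero_of_notMem_tsupport hx']
  have hint : ∀ {g ψ : E3 → ℂ}, Continuous g → Continuous ψ → HasCompactSupport ψ →
      Integrable (fun x => g x * ψ x) := fun hg hψ hψc =>
    (hg.mul hψ).integrable_of_hasCompactSupport hψc.mul_left
  rw [e1, e2, integral_mul_fderiv_eq_neg_fderiv_mul_of_integrable]
  · simp_rw [h]
  · simp_rw [h]
    exact hint hf' hφ.continuous hc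
  · exact hint hf h1 h2
  · exact hint hf hφ.continuous hc
  · exact fun x _ => hd x
  · exact fun x _ => hφ.differentiable (by simp) x

/-- The plane wave `z ↦ exp(-iτ(c⁻¹ x̂·z - t₀))`, the kernel of the data-to-pattern operator. -/
def wave (c t₀ : ℝ) (xhat : E3) (τ : ℝ) (z : E3) : ℂ :=
  Complex.exp (-Complex.I * τ * ((c⁻¹ * inner ℝ xhat z - t₀ : ℝ) : ℂ))

/-- The factor that the derivative in direction `eᵢ` brings down from `wave`. -/
def waveFactor (c : ℝ) (xhat : E3) (τ : ℝ) (i : Fin 3) : ℂ :=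
  -Complex.I * τ * ((c⁻¹ * inner ℝ xhat (stdVec i) : ℝ) : ℂ)

lemma continuous_wave₂ (c t₀ : ℝ) (xhat : E3) :
    Continuous (fun p : ℝ × E3 => wave c t₀ xhat p.1 p.2) := by
  unfold wave
  fun_prop

lemma continuous_wave (c t₀ : ℝ) (xhat : E3) (τ : ℝ) : Continuous (wave c t₀ xhat τ) := by
  unfold wave
  fun_prop

lemma hasFDerivAt_wave (c t₀ : ℝ) (xhat : E3) (τ : ℝ) (z : E3) :
    ∃ A : E3 →L[ℝ] ℂ, HasFDerivAt (wave c t₀ xhat τ) A z ∧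
      ∀ i, A (stdVec i) = waveFactor c xhat τ i * wave c t₀ xhat τ z := by
  have h1 : HasFDerivAt (fun z : E3 => c⁻¹ * inner ℝ xhat z - t₀)
      (c⁻¹ • innerSL ℝ xhat) z :=
    (((innerSL ℝ xhat).hasFDerivAt (x := z)).const_mul c⁻¹).sub_const t₀
  have h2 := ((Complex.ofRealCLM.hasFDerivAt.comp z h1).const_mul (-Complex.I * (τ : ℂ))).cexp
  refine ⟨_, h2, fun i => ?_⟩
  simp [wave, waveFactor]
  ring

lemma fderiv_wave (c t₀ : ℝ) (xhat : E3) (τ : ℝ) (i : Fin 3) (z : E3) :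
    fderiv ℝ (wave c t₀ xhat τ) z (stdVec i)
      = waveFactor c xhat τ i * wave c t₀ xhat τ z := by
  obtain ⟨A, hA, h⟩ := hasFDerivAt_wave c t₀ xhat τ z
  rw [hA.fderiv, h]

lemma differentiable_wave (c t₀ : ℝ) (xhat : E3) (τ : ℝ) :
    Differentiable ℝ (wave c t₀ xhat τ) := fun z =>
  let ⟨_, hA, _⟩ := hasFDerivAt_wave c t₀ xhat τ z
  hA.differentiableAt

/-- The components of the plane wave in `H²(D)`: the wave and its first and second derivatives. -/
def waveJet (c t₀ : ℝ) (xhat : E3) (τ : ℝ) : JetIndex → E3 → ℂ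
  | .inl _ => wave c t₀ xhat τ
  | .inr (.inl i) => fun z => waveFactor c xhat τ i * wave c t₀ xhat τ z
  | .inr (.inr (i, j)) => fun z =>
      waveFactor c xhat τ i * (waveFactor c xhat τ j * wave c t₀ xhat τ z)

lemma continuous_waveJet₂ (c t₀ : ℝ) (xhat : E3) (a : JetIndex) :
    Continuous (fun p : ℝ × E3 => waveJet c t₀ xhat p.1 a p.2) := by
  have h := continuous_wave₂ c t₀ xhat
  have hf : ∀ i, Continuous (fun p : ℝ × E3 => waveFactor c xhat p.1 i) := by
    intro i
    unfold waveFactor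
    fun_prop
  rcases a with _ | i | ⟨i, j⟩
  · exact h
  · exact (hf i).mul h
  · exact (hf i).mul ((hf j).mul h)

lemma continuous_waveJet (c t₀ : ℝ) (xhat : E3) (τ : ℝ) (a : JetIndex) :
    Continuous (waveJet c t₀ xhat τ a) :=
  (continuous_waveJet₂ c t₀ xhat a).comp (Continuous.prodMk_right τ)

/-- The plane wave, restricted to the bounded set `D`, as an element of `H²(D)`. -/
def waveH2 {D : Set E3} (hD : Bornology.IsBounded D) (c t₀ : ℝ) (xhat : E3) (τ : ℝ) : H2 D :=
  ⟨WithLp.toLp 2 fun a => toL2 hD (waveJet c t₀ xhat τ a) (continuous_waveJet c t₀ xhat τ a), by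
    have hw := continuous_waveJet c t₀ xhat τ
    refine ⟨fun i => hasWeakDeriv_toL2 hD i (hw (.inl ())) (hw (.inr (.inl i)))
      (differentiable_wave c t₀ xhat τ) (fderiv_wave c t₀ xhat τ i),
      fun i j => hasWeakDeriv_toL2 hD j (hw (.inr (.inl i))) (hw (.inr (.inr (i, j))))
      ((differentiable_wave c t₀ xhat τ).const_mul _) fun x => ?_⟩
    change fderiv ℝ (fun z => waveFactor c xhat τ i * wave c t₀ xhat τ z) x (stdVec j) = _
    rw [fderiv_const_mul (differentiable_wave c t₀ xhat τ x)]
    simp only [smul_apply, smul_eq_mul, fderiv_wave]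
    rfl⟩

lemma continuous_toL2_param {D : Set E3} (hD : Bornology.IsBounded D) {F : ℝ → E3 → ℂ}
    (hF : Continuous (fun p : ℝ × E3 => F p.1 p.2)) (hF' : ∀ τ, Continuous (F τ)) :
    Continuous (fun τ => toL2 hD (F τ) (hF' τ)) := by
  have := isFiniteMeasure_restrict hD
  set V : ℝ := ((volume : Measure E3).restrict D).real univ ^ ((2 : ENNReal).toReal)⁻¹ with hV
  have hV0 : 0 ≤ V := by positivity
  rw [Metric.continuous_iff']
  intro τ₀ ε hε
  have hu : TendstoUniformlyOn F (F τ₀) (𝓝 τ₀) (closure D) := by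
    let G : C(ℝ, C(E3, ℂ)) := ContinuousMap.curry ⟨fun p : ℝ × E3 => F p.1 p.2, hF⟩
    exact (ContinuousMap.tendsto_iff_forall_isCompact_tendstoUniformlyOn.1
      (G.continuous.tendsto τ₀)) _ hD.isCompact_closure
  have hδ : 0 < ε / (V + 1) := by positivity
  filter_upwards [Metric.tendstoUniformlyOn_iff.1 hu _ hδ] with τ hτ
  have hsub : toL2 hD (F τ) (hF' τ) - toL2 hD (F τ₀) (hF' τ₀)
      = ((memLp_of_continuous hD (hF' τ)).sub (memLp_of_continuous hD (hF' τ₀))).toLp _ :=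
    (MemLp.toLp_sub _ _).symm
  have hb : ‖toL2 hD (F τ) (hF' τ) - toL2 hD (F τ₀) (hF' τ₀)‖ ≤ V * (ε / (V + 1)) := by
    refine Lp.norm_le_of_ae_bound hδ.le ?_
    rw [hsub]
    filter_upwards [MemLp.coeFn_toLp ((memLp_of_continuous hD (hF' τ)).sub
      (memLp_of_continuous hD (hF' τ₀))), ae_mem_closure D] with x hx hxD
    rw [hx, Pi.sub_apply, ← dist_eq_norm, dist_comm]
    exact (hτ x hxD).le
  rw [dist_eq_norm]
  refine hb.trans_lt ?_
  rw [← mul_div_assoc, div_lt_iff₀ (by positivity)]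
  nlinarith

lemma continuous_waveH2 {D : Set E3} (hD : Bornology.IsBounded D) (c t₀ : ℝ) (xhat : E3) :
    Continuous (waveH2 hD c t₀ xhat) := by
  refine Continuous.subtype_mk ?_ _
  refine (PiLp.continuous_toLp 2 _).comp (continuous_pi fun a => ?_)
  exact continuous_toL2_param hD (continuous_waveJet₂ c t₀ xhat a) _

lemma memLp_interval (K : ℝ) {f : ℝ → ℂ} (hf : Continuous f) :
    MemLp f 2 ((volume : Measure ℝ).restrict (Ioo 0 K)) := by
  obtain ⟨C, hC⟩ := (isCompact_Icc (a := (0 : ℝ)) (b := K)).exists_bound_of_continuousOn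
    hf.continuousOn
  refine MemLp.of_bound hf.aestronglyMeasurable C ?_
  filter_upwards [ae_restrict_mem measurableSet_Ioo] with x hx using hC x (Ioo_subset_Icc_self hx)

lemma continuous_pairing {D : Set E3} (hD : Bornology.IsBounded D) (c t₀ : ℝ) (xhat : E3)
    (u : HNeg2 D) : Continuous (fun τ : ℝ => u (waveH2 hD c t₀ xhat τ)) :=
  u.continuous.comp (continuous_waveH2 hD c t₀ xhat)

/-- The data-to-pattern operator `L : H⁻²(D) → L²(0, K)`,
`(L u)(τ) = ∫_D exp(-iτ(c⁻¹ x̂·z - t₀)) u(z) dz`, where the integral denotes the (bilinear) duality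
pairing of `u ∈ H⁻²(D)` with the plane wave in `H²(D)`. -/
def dataToPattern {D : Set E3} (hD : Bornology.IsBounded D) (c t₀ : ℝ) (xhat : E3) (K : ℝ) :
    HNeg2 D →ₗ[ℂ] L2Interval K where
  toFun u := (memLp_interval K (continuous_pairing hD c t₀ xhat u)).toLp _
  map_add' _ _ := rfl
  map_smul' _ _ := rfl

lemma continuous_testFun (c : ℝ) (xhat y : E3) (η : ℝ) : Continuous (fun k : ℝ =>
    Complex.exp (-Complex.I * k * ((c⁻¹ * inner ℝ xhat y - η : ℝ) : ℂ))) := by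
  fun_prop

/-- The test function `φ_{y,η}(k) = exp(-ik(c⁻¹ x̂·y - η))`, as an element of `L²(0, K)`. -/
def testFunction (c : ℝ) (xhat : E3) (K : ℝ) (y : E3) (η : ℝ) : L2Interval K :=
  (memLp_interval K (continuous_testFun c xhat y η)).toLp _

/-- The projection `x̂·D ⊆ ℝ` of `D` along the direction `x̂`. -/
def projection (xhat : E3) (D : Set E3) : Set ℝ := {t | ∃ z ∈ D, t = inner ℝ xhat z}

/-- The closed strip
`{y | inf(x̂·D) - c t₀ + c η ≤ x̂·y ≤ sup(x̂·D) - c t₀ + c η}`. -/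
def shiftedStrip (D : Set E3) (c t₀ : ℝ) (xhat : E3) (η : ℝ) : Set E3 :=
  {y | sInf (projection xhat D) - c * t₀ + c * η ≤ inner ℝ xhat y ∧
    inner ℝ xhat y ≤ sSup (projection xhat D) - c * t₀ + c * η}

end FarField

end

/-! Both directions rest on pairing a functional `T` on H² with plane waves, that is, with functions
of the single variable x̂·z.

Necessity is of Paley–Wiener type. By Hahn–Banach and Riesz, `T` is a family of L² densities acting
on the jet, and each derivative of a plane wave only brings down a factor linear in the frequency.
The pairing is therefore the restriction of an entire function. If it equals e^{-iτs} on an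
interval, it does so on all of ℂ (`eq_of_eqOn_Ioo`). At ζ = ±ir, e^{±rs} is then at most a quadratic
in r times e^{rP}, with P a bound for ± the phase on D; letting r → ∞ gives ±s ≤ P
(`le_of_pairing_wave_eq`).

Sufficiency: the strip condition says that the required phase is attained at some z₀ in the closure
of D, so it is enough to evaluate plane waves at z₀ by a bounded functional on H². A truncated cone
at z₀ inside D has slices of area proportional to t², so pushing L² densities on it forward to the
line yields weights t·q(t) with q continuous (`exists_dual_ridge`). Such weights suffice: F(0) = ∫ t
(χF)'' dt for a cut-off χ (`integral_cutoff_exp`). -/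

namespace FarField

/-! ### Entire extension of the pairing and its exponential growth -/

open ComplexConjugate in
/-- Bounded functionals on `H²(D)` are represented by families of `L²` densities. -/
lemma exists_density {D : Set E3} (T : HNeg2 D) :
    ∃ g : JetIndex → L2 D, ∀ U : H2 D,
      T U = ∑ a, ∫ x in D, conj (g a x) * (U : PiLp 2 (fun _ : JetIndex => L2 D)) a x := by
  -- Extending to the Hilbert space of all L² families lets Riesz act there, so closedness of `H2 D`
  -- is not needed.
  obtain ⟨T', hT', -⟩ := exists_extension_norm_eq (H2 D) T
  refine ⟨fun a => (InnerProductSpace.toDual ℂ _).symm T' a, fun U => ?_⟩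
  rw [← hT' U, ← InnerProductSpace.toDual_symm_apply, PiLp.inner_apply]
  refine Finset.sum_congr rfl fun a _ => ?_
  rw [L2.inner_def]
  simp_rw [RCLike.inner_apply, mul_comm]

/-- The polynomial in the complexified frequency by which a component of the jet of the plane wave
differs from the wave itself. -/
noncomputable def waveCoeff (c : ℝ) (xhat : E3) (ζ : ℂ) : JetIndex → ℂ
  | .inl _ => 1
  | .inr (.inl i) => -Complex.I * ζ * ((c⁻¹ * inner ℝ xhat (stdVec i) : ℝ) : ℂ)
  | .inr (.inr (i, j)) => (-Complex.I * ζ * ((c⁻¹ * inner ℝ xhat (stdVec i) : ℝ) : ℂ)) *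
      (-Complex.I * ζ * ((c⁻¹ * inner ℝ xhat (stdVec j) : ℝ) : ℂ))

lemma waveJet_eq_waveCoeff_mul (c t₀ : ℝ) (xhat : E3) (τ : ℝ) (a : JetIndex) (z : E3) :
    waveJet c t₀ xhat τ a z = waveCoeff c xhat τ a * wave c t₀ xhat τ z := by
  rcases a with _ | i | ⟨i, j⟩ <;> simp [waveJet, waveCoeff, waveFactor, mul_assoc]

lemma differentiable_waveCoeff (c : ℝ) (xhat : E3) (a : JetIndex) :
    Differentiable ℂ (fun ζ => waveCoeff c xhat ζ a) := by
  rcases a with _ | i | ⟨i, j⟩ <;> simp only [waveCoeff] <;> fun_prop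

/-- Each derivative contributes one factor of size at most c⁻¹‖ζ‖; the square dominates orders 0, 1
and 2 at once. -/
lemma norm_waveCoeff_le {c : ℝ} (hc : 0 < c) {xhat : E3} (hxhat : ‖xhat‖ = 1) (ζ : ℂ)
    (a : JetIndex) : ‖waveCoeff c xhat ζ a‖ ≤ (1 + c⁻¹ * ‖ζ‖) ^ 2 := by
  have h0 : 0 ≤ c⁻¹ * ‖ζ‖ := by positivity
  have h : ∀ i : Fin 3,
      ‖-Complex.I * ζ * ((c⁻¹ * inner ℝ xhat (stdVec i) : ℝ) : ℂ)‖ ≤ c⁻¹ * ‖ζ‖ := by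
    intro i
    have h1 : |inner ℝ xhat (stdVec i)| ≤ 1 := by
      simpa [hxhat] using abs_real_inner_le_norm xhat (stdVec i)
    rw [norm_mul, norm_mul, norm_neg, Complex.norm_I, one_mul, Complex.norm_real, Real.norm_eq_abs,
      abs_mul, abs_of_pos (inv_pos.2 hc), ← mul_assoc, mul_comm ‖ζ‖]
    exact mul_le_of_le_one_right h0 h1
  rcases a with _ | i | ⟨i, j⟩
  · simp only [waveCoeff, norm_one]
    nlinarith
  · simp only [waveCoeff]
    nlinarith [h i]
  · simp only [waveCoeff]
    rw [norm_mul]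
    nlinarith [mul_le_mul (h i) (h j) (norm_nonneg _) h0]

/-- The Fourier–Laplace transform of an integrable density with bounded phase is entire. -/
lemma differentiable_integral_mul_cexp {α : Type*} [MeasurableSpace α] {μ : Measure α} {g : α → ℂ}
    (hg : Integrable g μ) {p : α → ℝ} (hp : AEMeasurable p μ) {B : ℝ}
    (hB : ∀ᵐ x ∂μ, |p x| ≤ B) :
    Differentiable ℂ (fun ζ : ℂ => ∫ x, g x * Complex.exp (-Complex.I * ζ * (p x : ℂ)) ∂μ) := by
  intro ζ₀
  have hpc : AEStronglyMeasurable (fun x => (p x : ℂ)) μ :=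
    (Complex.measurable_ofReal.comp_aemeasurable hp).aestronglyMeasurable
  have hF : ∀ ζ : ℂ,
      AEStronglyMeasurable (fun x => Complex.exp (-Complex.I * ζ * (p x : ℂ))) μ :=
    fun ζ => Complex.continuous_exp.comp_aestronglyMeasurable (hpc.const_mul _)
  have hn : ∀ (ζ : ℂ) (x : α), |p x| ≤ B →
      ‖Complex.exp (-Complex.I * ζ * (p x : ℂ))‖ ≤ Real.exp (‖ζ‖ * B) := by
    intro ζ x hx
    refine (Complex.norm_exp_le_exp_norm _).trans (Real.exp_le_exp.2 ?_)
    simp only [norm_mul, norm_neg, Complex.norm_I, one_mul, Complex.norm_real, Real.norm_eq_abs]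
    gcongr
  refine (hasDerivAt_integral_of_dominated_loc_of_deriv_le
    (F' := fun ζ x => g x * (Complex.exp (-Complex.I * ζ * (p x : ℂ)) * (-Complex.I * (p x : ℂ))))
    (bound := fun x => ‖g x‖ * (Real.exp ((‖ζ₀‖ + 1) * B) * B))
    (Metric.ball_mem_nhds ζ₀ one_pos) (.of_forall fun ζ => hg.aestronglyMeasurable.mul (hF ζ))
    ?_ ?_ ?_ (hg.norm.mul_const _) ?_).2.differentiableAt
  · refine hg.mul_bdd (c := Real.exp (‖ζ₀‖ * B)) (hF ζ₀) ?_
    filter_upwards [hB] with x hx using hn ζ₀ x hx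
  · exact hg.aestronglyMeasurable.mul ((hF ζ₀).mul (hpc.const_mul _))
  · filter_upwards [hB] with x hx ζ hζ
    have hB0 : 0 ≤ B := (abs_nonneg _).trans hx
    have hζ' : ‖ζ‖ ≤ ‖ζ₀‖ + 1 := by
      have := norm_sub_norm_le ζ ζ₀
      rw [Metric.mem_ball, dist_eq_norm] at hζ
      linarith
    rw [norm_mul, norm_mul]
    gcongr
    · exact (hn ζ x hx).trans (Real.exp_le_exp.2 (by gcongr))
    · simpa using hx
  · refine .of_forall fun x ζ _ => ?_
    have h1 : HasDerivAt (fun ζ : ℂ => -Complex.I * ζ * (p x : ℂ)) (-Complex.I * (p x : ℂ)) ζ := by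
      simpa using ((hasDerivAt_id ζ).const_mul (-Complex.I)).mul_const (p x : ℂ)
    exact h1.cexp.const_mul _

lemma nonpos_of_exp_le_sq {d A b : ℝ} (h : ∀ r : ℝ, 0 ≤ r → Real.exp (d * r) ≤ A * (1 + b * r) ^ 2) :
    d ≤ 0 := by
  by_contra! hd
  have h0 := (isLittleO_pow_exp_pos_mul_atTop 0 hd)
  have h1 := (isLittleO_pow_exp_pos_mul_atTop 1 hd)
  have h2 := (isLittleO_pow_exp_pos_mul_atTop 2 hd)
  have h3 : (fun r : ℝ => A * (1 + b * r) ^ 2) =o[Filter.atTop] fun r => Real.exp (d * r) := by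
    refine (((h0.const_mul_left A).add (h1.const_mul_left (2 * A * b))).add
      (h2.const_mul_left (A * b ^ 2))).congr_left fun r => ?_
    ring
  -- With the little-o constant 1/2, a positive exponential would be at most half of itself.
  have h4 := (h3.bound (half_pos one_pos)).and (Filter.eventually_ge_atTop (0 : ℝ))
  obtain ⟨r, hr, hr0⟩ := h4.exists
  have h5 := h r hr0
  have h6 := Real.exp_pos (d * r)
  rw [Real.norm_of_nonneg h6.le] at hr
  linarith [le_abs_self (A * (1 + b * r) ^ 2), Real.norm_eq_abs (A * (1 + b * r) ^ 2)]

/-- The Fourier–Laplace transform of an `L²` density along the phase of the plane waves. -/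
noncomputable def waveTransform {D : Set E3} (c t₀ : ℝ) (xhat : E3) (g : L2 D) (ζ : ℂ) : ℂ :=
  ∫ x in D, (starRingEnd ℂ) (g x) *
    Complex.exp (-Complex.I * ζ * ((c⁻¹ * inner ℝ xhat x - t₀ : ℝ) : ℂ))

lemma integrable_conj {D : Set E3} (hD : Bornology.IsBounded D) (g : L2 D) :
    Integrable (fun x => (starRingEnd ℂ) (g x)) (volume.restrict D) :=
  have := isFiniteMeasure_restrict hD
  MemLp.integrable (by norm_num : (1 : ENNReal) ≤ 2) (Lp.memLp g).star

lemma differentiable_waveTransform {D : Set E3} (hD : Bornology.IsBounded D) (c t₀ : ℝ)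
    (xhat : E3) (g : L2 D) : Differentiable ℂ (waveTransform c t₀ xhat g) := by
  have hpc : Continuous fun z : E3 => c⁻¹ * inner ℝ xhat z - t₀ := by fun_prop
  obtain ⟨B, hB⟩ := hD.isCompact_closure.exists_bound_of_continuousOn hpc.continuousOn
  exact differentiable_integral_mul_cexp (integrable_conj hD g) hpc.aemeasurable
    ((ae_mem_closure D).mono fun x hx => hB x hx)

/-- On the imaginary axis the oscillating kernel becomes a real exponential, whose growth sees the
extreme phases. -/
lemma neg_I_mul_I_mul (r ε q : ℝ) :
    -Complex.I * (Complex.I * (r * ε : ℝ)) * (q : ℂ) = ((r * (ε * q) : ℝ) : ℂ) := by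
  push_cast
  linear_combination (-(r * ε * q : ℂ)) * Complex.I_sq

lemma norm_waveTransform_le {D : Set E3} (hDo : IsOpen D) (hD : Bornology.IsBounded D) {c t₀ : ℝ}
    {xhat : E3} (g : L2 D) {ε P r : ℝ} (hr : 0 ≤ r)
    (hP : ∀ z ∈ D, ε * (c⁻¹ * inner ℝ xhat z - t₀) ≤ P) :
    ‖waveTransform c t₀ xhat g (Complex.I * (r * ε : ℝ))‖ ≤
      (∫ x in D, ‖(starRingEnd ℂ) (g x)‖) * Real.exp (r * P) := by
  rw [← integral_mul_const]
  refine norm_integral_le_of_norm_le ((integrable_conj hD g).norm.mul_const _) ?_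
  filter_upwards [ae_restrict_mem hDo.measurableSet] with x hx
  rw [norm_mul, neg_I_mul_I_mul, Complex.norm_exp, Complex.ofReal_re]
  gcongr
  exact hP x hx

/-- The pairing of a bounded functional with the plane waves in terms of Fourier–Laplace transforms
of `L²` densities. -/
lemma exists_pairing_eq_sum_waveTransform {D : Set E3} (hD : Bornology.IsBounded D) (c t₀ : ℝ)
    (xhat : E3) (T : HNeg2 D) : ∃ g : JetIndex → L2 D, ∀ τ : ℝ,
      T (waveH2 hD c t₀ xhat τ) =
        ∑ a, waveCoeff c xhat τ a * waveTransform c t₀ xhat (g a) τ := by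
  obtain ⟨g, hg⟩ := exists_density T
  refine ⟨g, fun τ => ?_⟩
  rw [hg]
  refine Finset.sum_congr rfl fun a _ => ?_
  rw [waveTransform, ← integral_const_mul]
  refine integral_congr_ae ?_
  filter_upwards [(memLp_of_continuous hD (continuous_waveJet c t₀ xhat τ a)).coeFn_toLp]
    with x hx
  change _ * (MemLp.toLp (waveJet c t₀ xhat τ a)
    (memLp_of_continuous hD (continuous_waveJet c t₀ xhat τ a)) : E3 → ℂ) x = _
  rw [hx, waveJet_eq_waveCoeff_mul, wave]
  ring

/-- Entire functions which agree on a real interval are equal. -/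
lemma eq_of_eqOn_Ioo {F G : ℂ → ℂ} (hF : Differentiable ℂ F) (hG : Differentiable ℂ G) {K : ℝ}
    (hK : 0 < K) (h : ∀ τ ∈ Ioo 0 K, F (τ : ℝ) = G (τ : ℝ)) : F = G := by
  refine AnalyticOnNhd.eq_of_frequently_eq (z₀ := ((K / 2 : ℝ) : ℂ))
    (fun z _ => hF.analyticAt z) (fun z _ => hG.analyticAt z) ?_
  have h1 : ∀ᶠ τ : ℝ in 𝓝[≠] (K / 2), F τ = G τ := by
    refine eventually_nhdsWithin_of_eventually_nhds ?_
    filter_upwards [Ioo_mem_nhds (half_pos hK) (half_lt_self hK)] with τ hτ using h τ hτ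
  refine Filter.Tendsto.frequently (p := fun ζ => F ζ = G ζ) ?_ h1.frequently
  refine tendsto_nhdsWithin_of_tendsto_nhds_of_eventually_within _
    (Complex.continuous_ofReal.continuousAt.tendsto.mono_left nhdsWithin_le_nhds) ?_
  filter_upwards [self_mem_nhdsWithin] with τ hτ using fun h => hτ (Complex.ofReal_injective h)

/-- Paley–Wiener type bound: if a bounded functional on `H²(D)` maps plane waves to `e^{-iτs}` for
`τ` in an interval, then `s` lies in every half-line which contains the phases over `D`. -/
lemma le_of_pairing_wave_eq {D : Set E3} (hDo : IsOpen D) (hD : Bornology.IsBounded D) {c t₀ K : ℝ}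
    (hc : 0 < c) (hK : 0 < K) {xhat : E3} (hxhat : ‖xhat‖ = 1) (T : HNeg2 D) {s : ℝ}
    (hT : ∀ τ ∈ Ioo 0 K, T (waveH2 hD c t₀ xhat τ) = Complex.exp (-Complex.I * τ * (s : ℂ)))
    {ε P : ℝ} (hε : |ε| = 1) (hP : ∀ z ∈ D, ε * (c⁻¹ * inner ℝ xhat z - t₀) ≤ P) :
    ε * s ≤ P := by
  obtain ⟨g, hg⟩ := exists_pairing_eq_sum_waveTransform hD c t₀ xhat T
  -- The identity known for real frequencies in the interval is carried to the imaginary axis.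
  have hΦ : (fun ζ => ∑ a, waveCoeff c xhat ζ a * waveTransform c t₀ xhat (g a) ζ)
      = fun ζ => Complex.exp (-Complex.I * ζ * (s : ℂ)) := by
    refine eq_of_eqOn_Ioo (Differentiable.fun_sum fun a _ => (differentiable_waveCoeff c xhat a).mul
      (differentiable_waveTransform hD c t₀ xhat (g a))) (by fun_prop) hK fun τ hτ => ?_
    rw [← hT τ hτ, hg]
  suffices ε * s - P ≤ 0 by linarith
  refine nonpos_of_exp_le_sq (A := ∑ a, ∫ x in D, ‖(starRingEnd ℂ) (g a x)‖) (b := c⁻¹)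
    fun r hr => ?_
  have hn : ‖Complex.I * (r * ε : ℝ)‖ = r := by
    rw [norm_mul, Complex.norm_I, one_mul, Complex.norm_real, Real.norm_eq_abs, abs_mul, hε,
      mul_one, abs_of_nonneg hr]
  have h1 : Real.exp (r * (ε * s)) ≤
      (∑ a, ∫ x in D, ‖(starRingEnd ℂ) (g a x)‖) * (1 + c⁻¹ * r) ^ 2 * Real.exp (r * P) := by
    have h2 := congrFun hΦ (Complex.I * (r * ε : ℝ))
    rw [neg_I_mul_I_mul] at h2
    rw [← Complex.ofReal_re (r * (ε * s)), ← Complex.norm_exp, ← h2, Finset.sum_mul,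
      Finset.sum_mul]
    refine (norm_sum_le _ _).trans (Finset.sum_le_sum fun a _ => ?_)
    rw [norm_mul, mul_comm (∫ x in D, ‖(starRingEnd ℂ) (g a x)‖), mul_assoc]
    have := norm_waveCoeff_le hc hxhat (Complex.I * (r * ε : ℝ)) a
    rw [hn] at this
    exact mul_le_mul this (norm_waveTransform_le hDo hD (g a) hr hP) (norm_nonneg _)
      (by positivity)
  have h3 : Real.exp ((ε * s - P) * r) = Real.exp (r * (ε * s)) / Real.exp (r * P) := by
    rw [← Real.exp_sub]
    ring_nf
  rw [h3, div_le_iff₀ (Real.exp_pos _)]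
  exact h1

/-! ### The strip in terms of the projection, and necessity -/

lemma mem_shiftedStrip_iff {D : Set E3} {c : ℝ} {t₀ η : ℝ} {xhat y : E3} :
    y ∈ shiftedStrip D c t₀ xhat η ↔
      inner ℝ xhat y - c * η + c * t₀ ∈
        Icc (sInf (projection xhat D)) (sSup (projection xhat D)) := by
  simp only [shiftedStrip, mem_ofPred_eq, mem_Icc]
  constructor <;> rintro ⟨h, h'⟩ <;> constructor <;> linarith

lemma projection_eq_image (xhat : E3) (D : Set E3) :
    projection xhat D = (fun z => inner ℝ xhat z) '' D := by
  ext t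
  simp [projection, eq_comm]

lemma isBounded_projection {D : Set E3} (hD : Bornology.IsBounded D) (xhat : E3) :
    Bornology.IsBounded (projection xhat D) := by
  rw [projection_eq_image]
  exact (hD.isCompact_closure.image (by fun_prop)).isBounded.subset (image_mono subset_closure)

lemma mem_shiftedStrip_of_mem_range {D : Set E3} (hD : IsBoundedLipschitzDomain D) {c : ℝ}
    (hc : 0 < c) {t₀ K : ℝ} (hK : 0 < K) {xhat : E3} (hxhat : ‖xhat‖ = 1) {η : ℝ} {y : E3}
    (h : testFunction c xhat K y η ∈ LinearMap.range (dataToPattern hD.isBounded c t₀ xhat K)) :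
    y ∈ shiftedStrip D c t₀ xhat η := by
  obtain ⟨T, hT⟩ := h
  have hae := (MemLp.toLp_eq_toLp_iff (memLp_interval K
    (continuous_pairing hD.isBounded c t₀ xhat T)) (memLp_interval K (continuous_testFun c xhat y η))).1 hT
  -- Equality in L² holds only almost everywhere; continuity in τ makes it pointwise.
  have hT' : ∀ τ ∈ Ioo 0 K, T (waveH2 hD.isBounded c t₀ xhat τ) =
      Complex.exp (-Complex.I * τ * ((c⁻¹ * inner ℝ xhat y - η : ℝ) : ℂ)) :=
    Measure.eqOn_open_of_ae_eq hae isOpen_Ioo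
      (continuous_pairing hD.isBounded c t₀ xhat T).continuousOn
      (continuous_testFun c xhat y η).continuousOn
  have hb := isBounded_projection hD.isBounded xhat
  have hmem : ∀ z ∈ D, inner ℝ xhat z ∈ projection xhat D := fun z hz => ⟨z, hz, rfl⟩
  have h1 := le_of_pairing_wave_eq hD.isOpen hD.isBounded hc hK hxhat T hT' (ε := 1)
    (P := c⁻¹ * sSup (projection xhat D) - t₀) (by simp) fun z hz => by
      have := mul_le_mul_of_nonneg_left (le_csSup hb.bddAbove (hmem z hz)) (inv_pos.2 hc).le
      linarith
  have h2 := le_of_pairing_wave_eq hD.isOpen hD.isBounded hc hK hxhat T hT' (ε := -1)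
    (P := -(c⁻¹ * sInf (projection xhat D) - t₀)) (by simp) fun z hz => by
      have := mul_le_mul_of_nonneg_left (csInf_le hb.bddBelow (hmem z hz)) (inv_pos.2 hc).le
      linarith
  have hcc : ∀ x : ℝ, c * (c⁻¹ * x) = x := fun x => mul_inv_cancel_left₀ hc.ne' x
  rw [mem_shiftedStrip_iff]
  constructor
  · have := mul_le_mul_of_nonneg_left h2 hc.le
    linarith [hcc (inner ℝ xhat y), hcc (sInf (projection xhat D))]
  · have := mul_le_mul_of_nonneg_left h1 hc.le
    linarith [hcc (inner ℝ xhat y), hcc (sSup (projection xhat D))]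

/-! ### Cones inside the domain and the area of their slices -/

/-- The interior cone condition, in a ball of radius `r` around a point of the closure. -/
lemma IsBoundedLipschitzDomain.exists_interior_cone {D : Set E3} (hD : IsBoundedLipschitzDomain D)
    {z₀ : E3} (hz₀ : z₀ ∈ closure D) :
    ∃ r > 0, ∃ U : Set E3, IsOpen U ∧ U.Nonempty ∧ (∀ t : ℝ, 0 < t → ∀ v ∈ U, t • v ∈ U) ∧
      ∀ v ∈ U, ‖v‖ < r → z₀ + v ∈ D := by
  by_cases hz : z₀ ∈ D
  · obtain ⟨r, hr, hrD⟩ := Metric.isOpen_iff.1 hD.isOpen z₀ hz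
    exact ⟨r, hr, univ, isOpen_univ, univ_nonempty, fun _ _ _ _ => mem_univ _, fun v _ hv =>
      hrD (by simpa using hv)⟩
  · obtain ⟨r, hr, e, he, M, g, hg, hx⟩ :=
      hD.lipschitz_boundary z₀ ⟨hz₀, by rwa [hD.isOpen.interior_eq]⟩
    -- Strictly below the graph there would be a neighbourhood of z₀ free of points of D.
    have hle : g (z₀ - inner ℝ e z₀ • e) ≤ inner ℝ e z₀ := by
      by_contra! hlt
      have hgc := hg.continuous
      have ho : IsOpen {x : E3 | inner ℝ e x < g (x - inner ℝ e x • e)} :=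
        isOpen_lt (by fun_prop) (by fun_prop)
      obtain ⟨x, ⟨hx1, hx2⟩, hxD⟩ := mem_closure_iff.1 hz₀ _ (ho.inter Metric.isOpen_ball)
        ⟨hlt, Metric.mem_ball_self hr⟩
      exact lt_asymm hx1 ((hx x hx2).1 hxD)
    refine ⟨r, hr, {v | M * ‖v - (inner ℝ e v : ℝ) • e‖ < inner ℝ e v},
      isOpen_lt (by fun_prop) (by fun_prop), ⟨e, ?_⟩, ?_, ?_⟩
    · simp [he]
    · intro t ht v hv
      simp only [mem_ofPred_eq, inner_smul_right] at hv ⊢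
      rw [mul_smul, ← smul_sub, norm_smul, Real.norm_of_nonneg ht.le, mul_left_comm]
      exact mul_lt_mul_of_pos_left hv ht
    · intro v hv hvr
      rw [hx _ (by simpa using hvr)]
      have h1 := hg.dist_le_mul (z₀ + v - inner ℝ e (z₀ + v) • e) (z₀ - inner ℝ e z₀ • e)
      have h2 : z₀ + v - (inner ℝ e (z₀ + v) : ℝ) • e - (z₀ - (inner ℝ e z₀ : ℝ) • e)
          = v - (inner ℝ e v : ℝ) • e := by
        rw [inner_add_right, add_smul]
        abel
      rw [dist_eq_norm, dist_eq_norm, h2, Real.norm_eq_abs] at h1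
      have h3 : M * ‖v - (inner ℝ e v : ℝ) • e‖ < inner ℝ e v := hv
      rw [inner_add_right] at h1 ⊢
      linarith [le_abs_self (g (z₀ + v - (inner ℝ e z₀ + inner ℝ e v) • e)
        - g (z₀ - inner ℝ e z₀ • e))]

/-- The density is the derivative of κt³, and `max 0 (min δ a)` clips a to [0, δ]; this distribution
function is matched with cone volumes. -/
lemma withDensity_sq_Iic {κ δ : ℝ} (hκ : 0 ≤ κ) (a : ℝ) :
    ((volume.restrict (Ioc 0 δ)).withDensity fun t : ℝ => ENNReal.ofReal (3 * κ * t ^ 2)) (Iic a)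
      = ENNReal.ofReal (κ * (max 0 (min δ a)) ^ 3) := by
  have hs : Iic a ∩ Ioc 0 δ = Ioc 0 (max 0 (min δ a)) := by
    ext x
    simp only [mem_inter_iff, mem_Iic, mem_Ioc, le_max_iff, le_min_iff]
    constructor
    · rintro ⟨h1, h2, h3⟩
      exact ⟨h2, .inr ⟨h3, h1⟩⟩
    · rintro ⟨h1, h2 | h2⟩
      · linarith
      · exact ⟨h2.2, h1, h2.1⟩
  rw [withDensity_apply _ measurableSet_Iic, Measure.restrict_restrict measurableSet_Iic, hs,
    ← ofReal_integral_eq_lintegral_ofReal, ← intervalIntegral.integral_of_le (le_max_left _ _)]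
  · congr 1
    rw [intervalIntegral.integral_const_mul, integral_pow]
    norm_num
    ring
  · exact ((by fun_prop : Continuous fun t : ℝ => 3 * κ * t ^ 2).integrableOn_Icc).mono_set
      Ioc_subset_Icc_self
  · exact .of_forall fun t => by positivity

open scoped Pointwise in
/-- Below a point of the closure of a bounded Lipschitz domain there is a subset whose area
distribution in the direction `xhat` (or its opposite) is exactly quadratic. -/
lemma IsBoundedLipschitzDomain.exists_quadratic_slices {D : Set E3}
    (hD : IsBoundedLipschitzDomain D) {z₀ : E3} (hz₀ : z₀ ∈ closure D) {xhat : E3}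
    (hxhat : ‖xhat‖ = 1) :
    ∃ σ : ℝ, σ ≠ 0 ∧ ∃ δ > 0, ∃ κ > 0, ∃ C : Set E3, MeasurableSet C ∧ C ⊆ D ∧
      (volume.restrict C).map (fun z => σ⁻¹ * (inner ℝ xhat z - inner ℝ xhat z₀)) =
        (volume.restrict (Ioc 0 δ)).withDensity fun t : ℝ => ENNReal.ofReal (3 * κ * t ^ 2) := by
  obtain ⟨r, hr, U, hUo, ⟨v₀, hv₀⟩, hUc, hUD⟩ := hD.exists_interior_cone hz₀
  -- The cone is open, so an axis orthogonal to x̂ can be tilted slightly towards x̂. The sign of σ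
  -- is left free.
  obtain ⟨e, heU, hσ⟩ : ∃ e ∈ U, (inner ℝ xhat e : ℝ) ≠ 0 := by
    by_cases h : (inner ℝ xhat v₀ : ℝ) = 0
    · have hlim : Filter.Tendsto (fun s : ℝ => v₀ + s • xhat) (𝓝[>] 0) (𝓝 v₀) := by
        have : Continuous (fun s : ℝ => v₀ + s • xhat) := by fun_prop
        simpa using (this.tendsto 0).mono_left nhdsWithin_le_nhds
      obtain ⟨s, hs, hs0⟩ := ((hlim.eventually (hUo.mem_nhds hv₀)).and self_mem_nhdsWithin).exists
      refine ⟨_, hs, ?_⟩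
      rw [inner_add_right, h, inner_smul_right, real_inner_self_eq_norm_sq, hxhat]
      simpa using (ne_of_gt hs0)
    · exact ⟨v₀, hv₀, h⟩
  set σ : ℝ := inner ℝ xhat e with hσdef
  set ℓ : E3 → ℝ := fun v => σ⁻¹ * inner ℝ xhat v with hℓ
  have hℓc : Continuous ℓ := by fun_prop
  have hℓe : ℓ e = 1 := inv_mul_cancel₀ hσ
  have hℓs : ∀ (t : ℝ) v, ℓ (t • v) = t * ℓ v := fun t v => by
    simp only [hℓ, inner_smul_right]
    ring
  set R : ℝ := ‖e‖ + 1 with hR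
  have hR0 : 0 < R := by positivity
  -- A narrower cone on which the height ℓ is positive and controls the norm, so that truncations
  -- are bounded; R > ‖e‖ keeps e inside.
  set V : Set E3 := U ∩ {v | ‖v‖ < R * ℓ v} with hV
  have hVo : IsOpen V := hUo.inter (isOpen_lt (by fun_prop) (by fun_prop))
  have heV : e ∈ V := ⟨heU, by simp [hℓe, hR]⟩
  have hVc : ∀ t : ℝ, 0 < t → ∀ v ∈ V, t • v ∈ V := by
    refine fun t ht v hv => ⟨hUc t ht v hv.1, ?_⟩
    have h1 : ‖v‖ < R * ℓ v := hv.2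
    simp only [mem_ofPred_eq]
    rw [hℓs, norm_smul, Real.norm_of_nonneg ht.le, mul_left_comm]
    exact mul_lt_mul_of_pos_left h1 ht
  have hVpos : ∀ v ∈ V, 0 < ℓ v := fun v hv =>
    pos_of_mul_pos_right ((norm_nonneg v).trans_lt hv.2) hR0.le
  set S : ℝ → Set E3 := fun t => V ∩ {v | ℓ v ≤ t} with hS
  have hSm : ∀ t, MeasurableSet (S t) := fun t =>
    hVo.measurableSet.inter (isClosed_le hℓc continuous_const).measurableSet
  have hS1 : volume (S 1) ≠ ⊤ := by
    refine (measure_mono (t := Metric.ball 0 R) fun v hv => ?_).trans_lt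
      Metric.isBounded_ball.measure_lt_top |>.ne
    have h1 : ‖v‖ < R * ℓ v := hv.1.2
    have h2 : ℓ v ≤ 1 := hv.2
    rw [mem_ball_zero_iff]
    nlinarith
  have hS1' : volume (S 1) ≠ 0 := by
    have ho : IsOpen (V ∩ {v | ℓ v < 1}) := hVo.inter (isOpen_lt hℓc continuous_const)
    have hne : (V ∩ {v | ℓ v < 1}).Nonempty :=
      ⟨(1 / 2 : ℝ) • e, hVc _ (by norm_num) e heV, by
        simp only [mem_ofPred_eq, hℓs, hℓe]
        norm_num⟩
    exact ((ho.measure_pos volume hne).trans_le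
      (measure_mono (inter_subset_inter_right V fun v (hv : ℓ v < 1) => hv.le))).ne'
  -- Homogeneity: S t is the dilate of S 1 by t, whence the cube in dimension three.
  have hSt : ∀ t, volume (S t) = ENNReal.ofReal ((volume (S 1)).toReal * (max 0 t) ^ 3) := by
    intro t
    rcases le_or_gt t 0 with ht | ht
    · have : S t = ∅ := by
        ext v
        simp only [mem_empty_iff_false, iff_false]
        exact fun hv => absurd (hVpos v hv.1) (not_lt.2 (le_trans hv.2 ht))
      simp [this, max_eq_left ht]
    · have : S t = t • S 1 := by
        ext v
        rw [mem_smul_set_iff_inv_smul_mem₀ ht.ne']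
        constructor
        · rintro ⟨h1, h2⟩
          refine ⟨hVc _ (inv_pos.2 ht) v h1, ?_⟩
          simp only [mem_ofPred_eq] at h2 ⊢
          rw [hℓs, inv_mul_le_iff₀ ht, mul_one]
          exact h2
        · rintro ⟨h1, h2⟩
          refine ⟨by simpa [smul_smul, ht.ne'] using hVc t ht _ h1, ?_⟩
          simp only [mem_ofPred_eq] at h2 ⊢
          rwa [hℓs, inv_mul_le_iff₀ ht, mul_one] at h2
      rw [this, Measure.addHaar_smul, max_eq_right ht.le, mul_comm,
        ENNReal.ofReal_mul ENNReal.toReal_nonneg, ENNReal.ofReal_toReal hS1, finrank_euclideanSpace,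
        Fintype.card_fin, abs_of_pos (by positivity)]
  -- Height at most δ forces ‖v‖ < Rδ = r, within reach of the cone condition.
  set δ : ℝ := r / R with hδ
  have hδ0 : 0 < δ := by positivity
  refine ⟨σ, hσ, δ, hδ0, (volume (S 1)).toReal, ENNReal.toReal_pos hS1' hS1,
    (fun z => z - z₀) ⁻¹' S δ, (hSm δ).preimage (by fun_prop), ?_, ?_⟩
  · intro z hz
    have h1 : ‖z - z₀‖ < R * ℓ (z - z₀) := hz.1.2
    have h2 : ℓ (z - z₀) ≤ δ := hz.2
    have h3 : R * ℓ (z - z₀) ≤ r :=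
      (mul_le_mul_of_nonneg_left h2 hR0.le).trans_eq (mul_div_cancel₀ _ hR0.ne')
    simpa using hUD _ hz.1.1 (h1.trans_le h3)
  · have hf : Measurable fun z : E3 => σ⁻¹ * (inner ℝ xhat z - inner ℝ xhat z₀) :=
      Continuous.measurable (by fun_prop)
    have hvol : ∀ t, volume ((fun z => z - z₀) ⁻¹' S t) = volume (S t) := fun t => by
      simp [sub_eq_add_neg]
    have hfin : IsFiniteMeasure (volume.restrict ((fun z => z - z₀) ⁻¹' S δ)) :=
      ⟨by rw [Measure.restrict_apply_univ, hvol, hSt]; exact ENNReal.ofReal_lt_top⟩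
    refine Measure.ext_of_Iic _ _ fun a => ?_
    rw [Measure.map_apply hf measurableSet_Iic, Measure.restrict_apply (hf measurableSet_Iic),
      withDensity_sq_Iic ENNReal.toReal_nonneg, ← hSt, ← hvol]
    congr 1
    ext z
    simp only [hS, hℓ, mem_inter_iff, mem_preimage, mem_Iic, mem_ofPred_eq, le_min_iff,
      inner_sub_right]
    tauto

/-! ### Functionals on L² from densities on a cone -/

lemma integral_withDensity_sq {κ δ : ℝ} (hκ : 0 < κ) (hδ : 0 < δ) (F : ℝ → ℂ) :
    ∫ t, F t ∂((volume.restrict (Ioc 0 δ)).withDensity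
      fun t : ℝ => ENNReal.ofReal (3 * κ * t ^ 2)) =
      ∫ t in (0 : ℝ)..δ, ((3 * κ * t ^ 2 : ℝ) : ℂ) * F t := by
  rw [integral_withDensity_eq_integral_toReal_smul (by fun_prop)
    (.of_forall fun _ => ENNReal.ofReal_lt_top), intervalIntegral.integral_of_le hδ.le]
  refine integral_congr_ae (.of_forall fun t => ?_)
  simp only [ENNReal.toReal_ofReal (by positivity : 0 ≤ 3 * κ * t ^ 2), Complex.real_smul]

/-- The quadratic slice area absorbs the square of the 1/t singularity. Hence weights vanishing only
linearly at the apex are admissible. -/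
lemma memLp_div_withDensity_sq {κ δ : ℝ} (hκ : 0 < κ) {q : ℝ → ℂ} (hq : Continuous q) :
    MemLp (fun t : ℝ => q t / ((3 * κ * t : ℝ) : ℂ)) 2 ((volume.restrict (Ioc 0 δ)).withDensity
      fun t : ℝ => ENNReal.ofReal (3 * κ * t ^ 2)) := by
  have hm : Measurable fun t : ℝ => q t / ((3 * κ * t : ℝ) : ℂ) :=
    hq.measurable.div (Complex.measurable_ofReal.comp (by fun_prop))
  rw [memLp_two_iff_integrable_sq_norm hm.aestronglyMeasurable,
    integrable_withDensity_iff_integrable_smul' (by fun_prop)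
      (.of_forall fun _ => ENNReal.ofReal_lt_top)]
  have hc : IntegrableOn (fun t : ℝ => ‖q t‖ ^ 2 / (3 * κ)) (Ioc 0 δ) :=
    (by fun_prop : Continuous fun t : ℝ => ‖q t‖ ^ 2 / (3 * κ)).integrableOn_Icc.mono_set
      Ioc_subset_Icc_self
  refine hc.congr ?_
  filter_upwards [ae_restrict_mem measurableSet_Ioc] with t ht
  have ht0 : 0 < t := ht.1
  rw [ENNReal.toReal_ofReal (by positivity), norm_div, Complex.norm_real,
    Real.norm_of_nonneg (by positivity), smul_eq_mul]
  field_simp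

/-- An `L²` density defines a bounded functional on `L²(D)`. -/
lemma exists_dual_eq_integral_mul {D : Set E3} {h : E3 → ℂ}
    (hh : MemLp h 2 (volume.restrict D)) :
    ∃ A : StrongDual ℂ (L2 D), ∀ u, A u = ∫ x in D, h x * u x := by
  -- The conjugate offsets the conjugate-linearity of the inner product in its first slot.
  refine ⟨innerSL ℂ (hh.star.toLp), fun u => ?_⟩
  rw [innerSL_apply_apply, L2.inner_def]
  refine integral_congr_ae ?_
  filter_upwards [hh.star.coeFn_toLp] with x hx
  simp [hx, mul_comm]

/-- Bounded functionals on `L²(D)` which act on functions of `xhat · z` as weighted integrals with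
a weight vanishing linearly at the value `xhat · z₀`. -/
lemma IsBoundedLipschitzDomain.exists_dual_ridge {D : Set E3} (hD : IsBoundedLipschitzDomain D)
    {z₀ : E3} (hz₀ : z₀ ∈ closure D) {xhat : E3} (hxhat : ‖xhat‖ = 1) :
    ∃ σ : ℝ, σ ≠ 0 ∧ ∃ δ > 0, ∀ q : ℝ → ℂ, Continuous q → ∃ A : StrongDual ℂ (L2 D),
      ∀ (F : ℝ → ℂ) (f : E3 → ℂ) (hf : Continuous f), Continuous F →
        (∀ z, f z = F (σ⁻¹ * (inner ℝ xhat z - inner ℝ xhat z₀))) →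
        A (toL2 hD.isBounded f hf) = ∫ t in (0 : ℝ)..δ, t * q t * F t := by
  obtain ⟨σ, hσ, δ, hδ, κ, hκ, C, hCm, hCD, hmap⟩ := hD.exists_quadratic_slices hz₀ hxhat
  set p : E3 → ℝ := fun z => σ⁻¹ * (inner ℝ xhat z - inner ℝ xhat z₀) with hp
  have hpc : Continuous p := by fun_prop
  refine ⟨σ, hσ, δ, hδ, fun q hq => ?_⟩
  -- Chosen so that multiplication by the slice density 3κt² leaves t·q(t).
  set g : ℝ → ℂ := fun t => q t / ((3 * κ * t : ℝ) : ℂ) with hg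
  have hgm : Measurable g := hq.measurable.div (Complex.measurable_ofReal.comp (by fun_prop))
  have hgp : MemLp (g ∘ p) 2 (volume.restrict C) := by
    rw [← memLp_map_measure_iff hgm.aestronglyMeasurable hpc.aemeasurable, hmap]
    exact memLp_div_withDensity_sq hκ hq
  have hgD : MemLp (C.indicator (g ∘ p)) 2 (volume.restrict D) := by
    rwa [memLp_indicator_iff_restrict hCm, Measure.restrict_restrict hCm,
      inter_eq_left.2 hCD]
  obtain ⟨A, hA⟩ := exists_dual_eq_integral_mul hgD
  refine ⟨A, fun F f hf hF hfF => ?_⟩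
  have h1 : A (toL2 hD.isBounded f hf) = ∫ z in D, C.indicator (fun z => g (p z) * F (p z)) z := by
    rw [hA]
    refine integral_congr_ae ?_
    filter_upwards [(memLp_of_continuous hD.isBounded hf).coeFn_toLp] with z hz
    rw [toL2, hz, hfF]
    by_cases hzC : z ∈ C <;> simp [hzC, hp]
  rw [h1, setIntegral_indicator hCm, inter_eq_right.2 hCD,
    ← integral_map (f := fun t => g t * F t) hpc.aemeasurable
      (hgm.mul hF.measurable).aestronglyMeasurable, hmap, integral_withDensity_sq hκ hδ]
  refine intervalIntegral.integral_congr fun t _ => ?_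
  rcases eq_or_ne t 0 with rfl | ht
  · simp
  · have ht' : (t : ℂ) ≠ 0 := by exact_mod_cast ht
    have hκ' : (κ : ℂ) ≠ 0 := by exact_mod_cast hκ.ne'
    simp only [hg]
    push_cast
    field_simp

/-! ### Evaluation of plane waves at points of the closure -/

/-- Integration by parts against the cut-off `(1 - t/δ)²`: the value at `0` of an exponential is a
weighted integral of its derivatives of order at most two with weights vanishing linearly at `0`. -/
lemma integral_cutoff_exp (a b : ℂ) {δ : ℝ} (hδ : δ ≠ 0) :
    (∫ t in (0 : ℝ)..δ, (t : ℂ) * (2 / (δ : ℂ) ^ 2) * Complex.exp (a + b * t)) +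
      b * (∫ t in (0 : ℝ)..δ,
        (t : ℂ) * (-(4 / (δ : ℂ)) * (1 - t / δ)) * Complex.exp (a + b * t)) +
      b ^ 2 * (∫ t in (0 : ℝ)..δ, (t : ℂ) * (1 - t / δ) ^ 2 * Complex.exp (a + b * t)) =
    Complex.exp a := by
  have hδ' : (δ : ℂ) ≠ 0 := by exact_mod_cast hδ
  have hint : ∀ f : ℝ → ℂ, Continuous f → IntervalIntegrable f volume 0 δ :=
    fun f hf => hf.intervalIntegrable _ _
  rw [← intervalIntegral.integral_const_mul, ← intervalIntegral.integral_const_mul,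
    ← intervalIntegral.integral_add (hint _ (by fun_prop)) (hint _ (by fun_prop)),
    ← intervalIntegral.integral_add (hint _ (by fun_prop)) (hint _ (by fun_prop))]
  -- With χ = (1 - t/δ)² and F the exponential, t(χF)' - χF is a primitive of t(χF)''. As χ and χ'
  -- vanish at δ, only F(0) survives.
  have hd : ∀ t ∈ uIcc 0 δ, HasDerivAt
      (fun t : ℝ => ((t : ℂ) * (-(2 / (δ : ℂ)) * (1 - t / δ) + (1 - t / δ) ^ 2 * b)
        - (1 - t / δ) ^ 2) * Complex.exp (a + b * t))
      ((t : ℂ) * (2 / (δ : ℂ) ^ 2) * Complex.exp (a + b * t) +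
        b * ((t : ℂ) * (-(4 / (δ : ℂ)) * (1 - t / δ)) * Complex.exp (a + b * t)) +
        b ^ 2 * ((t : ℂ) * (1 - t / δ) ^ 2 * Complex.exp (a + b * t))) t := by
    intro t _
    have ht : HasDerivAt (fun s : ℝ => (s : ℂ)) 1 t := Complex.ofRealCLM.hasDerivAt
    have hχ : HasDerivAt (fun s : ℝ => 1 - (s : ℂ) / δ) (-(1 / (δ : ℂ))) t :=
      (ht.div_const (δ : ℂ)).const_sub 1
    have hχ2 : HasDerivAt (fun s : ℝ => (1 - (s : ℂ) / δ) ^ 2)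
        (2 * (1 - (t : ℂ) / δ) * (-(1 / (δ : ℂ)))) t :=
      (hχ.pow 2).congr_deriv (by push_cast; ring)
    have he := ((ht.const_mul b).const_add a).cexp
    refine (((ht.mul ((hχ.const_mul (-(2 / (δ : ℂ)))).add (hχ2.mul_const b))).sub hχ2).mul he).congr_deriv ?_
    simp only [Pi.add_apply, Pi.mul_apply, Pi.sub_apply]
    field_simp
    ring
  rw [intervalIntegral.integral_eq_sub_of_hasDerivAt hd (hint _ (by fun_prop))]
  simp [hδ']

lemma toL2_waveJet {D : Set E3} (hD : Bornology.IsBounded D) (c t₀ : ℝ) (xhat : E3) (τ : ℝ)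
    (a : JetIndex) :
    toL2 hD (waveJet c t₀ xhat τ a) (continuous_waveJet c t₀ xhat τ a) =
      waveCoeff c xhat τ a • toL2 hD (wave c t₀ xhat τ) (continuous_wave c t₀ xhat τ) := by
  refine Eq.trans ?_ (MemLp.toLp_const_smul _ _)
  refine MemLp.toLp_congr _ _ (.of_forall fun z => ?_)
  simp [waveJet_eq_waveCoeff_mul]

/-- Families of functionals on `L²(D)`, one for each component of the jet, act on `H²(D)`. -/
lemma exists_pairing_eq_sum_waveCoeff {D : Set E3} (hD : Bornology.IsBounded D)
    (A : JetIndex → StrongDual ℂ (L2 D)) :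
    ∃ T : HNeg2 D, ∀ c t₀ xhat τ, T (waveH2 hD c t₀ xhat τ) = ∑ a, waveCoeff c xhat τ a *
      A a (toL2 hD (wave c t₀ xhat τ) (continuous_wave c t₀ xhat τ)) := by
  refine ⟨∑ a, (A a).comp ((PiLp.proj 2 (fun _ : JetIndex => L2 D) a).comp (H2 D).subtypeL),
    fun c t₀ xhat τ => ?_⟩
  rw [_root_.sum_apply]
  refine Finset.sum_congr rfl fun a _ => ?_
  rw [← smul_eq_mul, ← map_smul, ← toL2_waveJet]
  rfl

/-- Contracting the coefficients of the wave jet with `σ xhat` gives its directional derivatives. -/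
lemma sum_mul_waveCoeff (c σ : ℝ) {xhat : E3} (hxhat : ‖xhat‖ = 1) (ζ : ℂ) :
    ∑ i, ((σ * xhat i : ℝ) : ℂ) * waveCoeff c xhat ζ (.inr (.inl i)) =
      -Complex.I * ζ * (c⁻¹ * σ : ℝ) := by
  have hsum : ∑ i, ((xhat i : ℝ) : ℂ) * (xhat i : ℝ) = 1 := by
    have := EuclideanSpace.real_norm_sq_eq xhat
    rw [hxhat] at this
    exact_mod_cast (by simpa [sq] using this.symm : ∑ i, xhat i * xhat i = 1)
  rw [← mul_one (-Complex.I * ζ * (c⁻¹ * σ : ℝ)), ← hsum, Finset.mul_sum]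
  refine Finset.sum_congr rfl fun i _ => ?_
  simp only [waveCoeff, EuclideanSpace.inner_single_right]
  push_cast
  simp
  ring

/-- Functionals acting on a function and its first two derivatives in the direction `σ xhat`. -/
lemma exists_pairing_eq_directional {D : Set E3} (hD : Bornology.IsBounded D)
    (A₀ A₁ A₂ : StrongDual ℂ (L2 D)) (c t₀ σ : ℝ) {xhat : E3} (hxhat : ‖xhat‖ = 1) :
    ∃ T : HNeg2 D, ∀ τ : ℝ, T (waveH2 hD c t₀ xhat τ) =
      A₀ (toL2 hD (wave c t₀ xhat τ) (continuous_wave c t₀ xhat τ)) +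
      (-Complex.I * τ * (c⁻¹ * σ : ℝ)) *
        A₁ (toL2 hD (wave c t₀ xhat τ) (continuous_wave c t₀ xhat τ)) +
      (-Complex.I * τ * (c⁻¹ * σ : ℝ)) ^ 2 *
        A₂ (toL2 hD (wave c t₀ xhat τ) (continuous_wave c t₀ xhat τ)) := by
  -- The coefficients are those of σx̂·∇ and its square; on functions of σ⁻¹x̂·z this operator is
  -- d/dt.
  obtain ⟨T, hT⟩ := exists_pairing_eq_sum_waveCoeff hD (Sum.elim (fun _ => A₀)
    (Sum.elim (fun i => ((σ * xhat i : ℝ) : ℂ) • A₁)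
      (fun ij => (((σ * xhat ij.1 : ℝ) : ℂ) * ((σ * xhat ij.2 : ℝ) : ℂ)) • A₂)))
  refine ⟨T, fun τ => ?_⟩
  rw [hT]
  generalize toL2 hD (wave c t₀ xhat τ) (continuous_wave c t₀ xhat τ) = w
  have hs2 : ∑ i, ∑ j, ((σ * xhat i : ℝ) : ℂ) * ((σ * xhat j : ℝ) : ℂ) *
      waveCoeff c xhat τ (.inr (.inr (i, j))) = (-Complex.I * τ * (c⁻¹ * σ : ℝ)) ^ 2 := by
    rw [sq, ← sum_mul_waveCoeff c σ hxhat, Finset.sum_mul_sum]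
    refine Finset.sum_congr rfl fun i _ => Finset.sum_congr rfl fun j _ => ?_
    simp only [waveCoeff]
    ring
  rw [← hs2, ← sum_mul_waveCoeff c σ hxhat, Fintype.sum_sum_type, Fintype.sum_sum_type,
    Fintype.sum_prod_type, add_assoc]
  simp only [Sum.elim_inl, Sum.elim_inr, smul_apply, smul_eq_mul, Finset.sum_mul]
  congr 1
  · simp [waveCoeff]
  · congr 1
    · exact Finset.sum_congr rfl fun i _ => by ring
    · exact Finset.sum_congr rfl fun i _ => Finset.sum_congr rfl fun j _ => by ring

/-- Plane waves can be evaluated at every point of the closure by bounded functionals on `H²(D)`. -/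
lemma IsBoundedLipschitzDomain.exists_pairing_wave_eq {D : Set E3}
    (hD : IsBoundedLipschitzDomain D) {z₀ : E3} (hz₀ : z₀ ∈ closure D) (c t₀ : ℝ) {xhat : E3}
    (hxhat : ‖xhat‖ = 1) :
    ∃ T : HNeg2 D, ∀ τ, T (waveH2 hD.isBounded c t₀ xhat τ) = wave c t₀ xhat τ z₀ := by
  obtain ⟨σ, hσ, δ, hδ, hA⟩ := hD.exists_dual_ridge hz₀ hxhat
  -- The three weights are χ'', 2χ' and χ, the Leibniz coefficients of (χF)'' for χ = (1 - t/δ)².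
  obtain ⟨A₀, hA₀⟩ := hA (fun _ => 2 / (δ : ℂ) ^ 2) (by fun_prop)
  obtain ⟨A₁, hA₁⟩ := hA (fun t => -(4 / (δ : ℂ)) * (1 - t / δ)) (by fun_prop)
  obtain ⟨A₂, hA₂⟩ := hA (fun t => (1 - t / δ) ^ 2) (by fun_prop)
  obtain ⟨T, hT⟩ := exists_pairing_eq_directional hD.isBounded A₀ A₁ A₂ c t₀ σ hxhat
  refine ⟨T, fun τ => ?_⟩
  set b : ℂ := -Complex.I * τ * (c⁻¹ * σ : ℝ) with hb
  set a : ℂ := -Complex.I * τ * ((c⁻¹ * inner ℝ xhat z₀ - t₀ : ℝ) : ℂ) with ha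
  have hF : ∀ z, wave c t₀ xhat τ z =
      (fun t : ℝ => Complex.exp (a + b * t)) (σ⁻¹ * (inner ℝ xhat z - inner ℝ xhat z₀)) := by
    intro z
    have hσ' : (σ : ℂ) ≠ 0 := by exact_mod_cast hσ
    simp only [wave, ha, hb]
    congr 1
    push_cast
    rw [mul_assoc _ _ ((σ : ℂ)⁻¹ * _), mul_assoc _ _ ((σ : ℂ)⁻¹ * _), mul_inv_cancel_left₀ hσ']
    ring
  have hFc : Continuous fun t : ℝ => Complex.exp (a + b * t) := by fun_prop
  rw [hT, hA₀ _ _ _ hFc hF, hA₁ _ _ _ hFc hF, hA₂ _ _ _ hFc hF, integral_cutoff_exp a b hδ.ne']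
  rfl

/-! ### Attaining the phase, and the theorem -/

/-- Every value between the infimum and the supremum of the projection is attained on the closure. -/
lemma exists_mem_closure_inner_eq {D : Set E3} (hDc : IsConnected D) (hD : Bornology.IsBounded D)
    (xhat : E3) {a : ℝ} (ha : a ∈ Icc (sInf (projection xhat D)) (sSup (projection xhat D))) :
    ∃ z ∈ closure D, inner ℝ xhat z = a := by
  have hb := isBounded_projection hD xhat
  have hcont : Continuous fun z : E3 => (inner ℝ xhat z : ℝ) := by fun_prop
  have hne : (projection xhat D).Nonempty := by
    rw [projection_eq_image]
    exact hDc.nonempty.image _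
  have hsub : closure (projection xhat D) ⊆ (fun z => inner ℝ xhat z) '' closure D := by
    refine closure_minimal ?_ (hD.isCompact_closure.image hcont).isClosed
    rw [projection_eq_image]
    exact image_mono subset_closure
  -- Compactness of the closure attains both extremes; connectedness fills in the values between.
  exact (hDc.isPreconnected.closure.image _ hcont.continuousOn).Icc_subset
    (hsub (csInf_mem_closure hne hb.bddBelow)) (hsub (csSup_mem_closure hne hb.bddAbove)) ha

end FarField

theorem theorem3p1 {D : Set FarField.E3} (hD : FarField.IsBoundedLipschitzDomain D)
    {c : ℝ} (hc : 0 < c) (t₀ : ℝ) {K : ℝ} (hK : 0 < K)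
    (xhat : FarField.E3) (hxhat : ‖xhat‖ = 1) (η : ℝ) (y : FarField.E3) :
    FarField.testFunction c xhat K y η ∈
        LinearMap.range (FarField.dataToPattern hD.isBounded c t₀ xhat K) ↔
      y ∈ FarField.shiftedStrip D c t₀ xhat η := by
  refine ⟨FarField.mem_shiftedStrip_of_mem_range hD hc hK hxhat, fun hy => ?_⟩
  -- The point satisfies x̂·z₀ = x̂·y - cη + ct₀; division by c turns the test function into the
  -- plane wave at z₀.
  obtain ⟨z₀, hz₀, hval⟩ := FarField.exists_mem_closure_inner_eq hD.isConnected hD.isBounded xhat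
    (FarField.mem_shiftedStrip_iff.1 hy)
  obtain ⟨T, hT⟩ := hD.exists_pairing_wave_eq hz₀ c t₀ hxhat
  refine ⟨T, MemLp.toLp_congr
    (FarField.memLp_interval K (FarField.continuous_pairing hD.isBounded c t₀ xhat T))
    (FarField.memLp_interval K (FarField.continuous_testFun c xhat y η)) (.of_forall fun τ => ?_)⟩
  have hphase : c⁻¹ * inner ℝ xhat z₀ - t₀ = c⁻¹ * inner ℝ xhat y - η := by
    rw [hval]
    field_simp
    ring
  beta_reduce
  rw [hT, FarField.wave, hphase]
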